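/- Let $\delta>0$. A geodesic metric space is called $\delta$-hyperbolic if each side of every geodesic triangle lies in the closed $\delta$-neighbourhood of the union of the other two sides. For an isometry $f$ of a metric space $S$ write $\tau(f)=\lim_{n\to\infty} d(x,f^nx)/n$ for its translation length (independent of $x\in S$), and call $x\in S$ \emph{almost minimal} for $f$ if $d(x,fx)-\inf_{z\in S}d(z,fz)\le\delta$. Call a pair of constants $T,K>0$ \emph{admissible} (for $\delta$) if for every nonempty $\delta$-hyperbolic space $S$, every isometry $f$ of $S$ with $\tau(f)\ge T$, every almost minimal point $x$ for $f$ and every integer $i\ge 0$ one has $i\,\tau(f)\le d(x,f^ix)\le i\,\tau(f)+K$. Let a group $\Gamma$ act by isometries on a metric space $S$. For a path $w$ of finite length $|w|$, a real number $0<W<|w|$ and $x,y\in S$ put $$c_{w,W}([x,y])=d(x,y)-\inf_\alpha\bigl(|\alpha|-W|\alpha|_w\bigr),$$ where $\alpha$ ranges over the paths from $x$ to $y$ and $|\alpha|_w$ is the maximal number of non-overlapping subpaths of $\alpha$ that are oriented copies $aw$ ($a\in\Gamma$) of $w$; for $x_0\in S$ and $a\in\Gamma$ put $h_{w,W,x_0}(a)=c_{w,W}([x_0,ax_0])-c_{w^{-1},W}([x_0,ax_0])$,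 where $w^{-1}$ is $w$ traversed backwards. For $f\in\Gamma$ with $\tau(f)\ge 2K+2$, an almost minimal point $x_0$ for $f$ and a geodesic $[x_0,fx_0]$, write $h_f=h_{[x_0,fx_0],\,K+1,\,x_0}$. The homogenization of $\psi:\Gamma\to\mathbb{R}$ is $\overline{\psi}(a)=\lim_{n\to\infty}\psi(a^n)/n$. The action is acylindrical with parameters $R:(0,\infty)\to(0,\infty)$ and $N:(0,\infty)\to\mathbb{Z}_{>0}$ if for all $r>0$ and all $x,x'\in S$ with $d(x,x')\ge R(r)$ there are at most $N(r)$ elements $a\in\Gamma$ with $d(x,ax)\le r$ and $d(x',ax')\le r$. An element $g\in\Gamma$ is loxodromic if $\tau(g)>0$, and chiral if for no integer $m>0$ the element $g^m$ is conjugate to $g^{-m}$. \textbf{Theorem.} Let $\delta>0$. Admissible constants for $\delta$ exist. Fix admissible constants $T,K$. Then for all $R,N$ there is an integer $M>0$, depending only on $\delta$ (with the fixed $T,K$) and on $R,N$, such that for every nonempty $\delta$-hyperbolic space $S$, every group $\Gamma$ acting on $S$ by isometries and acylindrically with parameters $R,N$, and every chiral loxodromic $g\in\Gamma$: one has $\tau(g^M)\ge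 2K+2$, and for every almost minimal point $x_0$ for $g^M$ and every geodesic $[x_0,g^Mx_0]$, the limit defining $\overline{h_{g^M}}(g)$ exists and $$\overline{h_{g^M}}(g)\ \ge\ \frac1M .$$ -/

import Mathlib

open Filter Topology

noncomputable section

namespace AcylGap

universe u v

/-! ### Paths, geodesics, hyperbolic spaces -/

/-- A path of finite length, parametrised by arc length on `[0, len]`: the variation of `toFun` on
each `[s, t] ⊆ [0, len]` is `t - s`. Values of `toFun` outside `[0, len]` are irrelevant. Length,
subpaths and copies of a path do not depend on the parametrisation, so that every path of finite
length is represented. -/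
structure ArcPath (S : Type u) [MetricSpace S] where
  len : ℝ
  len_nonneg : 0 ≤ len
  toFun : ℝ → S
  unitSpeed : HasUnitSpeedOn toFun (Set.Icc 0 len)

namespace ArcPath

variable {S : Type u} [MetricSpace S]

def source (p : ArcPath S) : S := p.toFun 0

def target (p : ArcPath S) : S := p.toFun p.len

def image (p : ArcPath S) : Set S := p.toFun '' Set.Icc 0 p.len

theorem reverse_unitSpeed (p : ArcPath S) :
    HasUnitSpeedOn (fun t => p.toFun (p.len - t)) (Set.Icc 0 p.len) := by
  intro x hx y hy
  have hanti : AntitoneOn (fun t : ℝ => p.len - t) (Set.Icc 0 p.len ∩ Set.Icc x y) :=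
    fun a _ b _ hab => sub_le_sub_left hab _
  have h := eVariationOn.comp_eq_of_antitoneOn p.toFun (fun t : ℝ => p.len - t) hanti
  have himg : (fun t : ℝ => p.len - t) '' (Set.Icc 0 p.len ∩ Set.Icc x y)
      = Set.Icc 0 p.len ∩ Set.Icc (p.len - y) (p.len - x) := by
    rw [Set.Icc_inter_Icc, Set.Icc_inter_Icc, Set.image_const_sub_Icc]
    congr 1
    · rw [min_eq_right hy.2, max_eq_right (by linarith [hy.2])]
    · rw [max_eq_right hx.1, min_eq_right (by linarith [hx.1])]
  rw [himg] at h
  have h' := p.unitSpeed (x := p.len - y) ⟨by linarith [hy.2], by linarith [hy.1]⟩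
    (y := p.len - x) ⟨by linarith [hx.2], by linarith [hx.1]⟩
  have e : (p.len - x) - (p.len - y) = y - x := by ring
  rw [e] at h'
  exact h.trans h'

/-- The path `p` traversed backwards. -/
def reverse (p : ArcPath S) : ArcPath S where
  len := p.len
  len_nonneg := p.len_nonneg
  toFun t := p.toFun (p.len - t)
  unitSpeed := p.reverse_unitSpeed

/-- `p` is a geodesic from `x` to `y`. -/
def IsGeodesic (p : ArcPath S) (x y : S) : Prop :=
  p.source = x ∧ p.target = y ∧
    ∀ s ∈ Set.Icc 0 p.len, ∀ t ∈ Set.Icc 0 p.len, dist (p.toFun s) (p.toFun t) = |s - t|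

end ArcPath

/-- The closed `r`-neighbourhood of a (nonempty) set. -/
def nbhd {S : Type u} [MetricSpace S] (A : Set S) (r : ℝ) : Set S :=
  {x | Metric.infDist x A ≤ r}

/-- `S` is a `δ`-hyperbolic space: a geodesic space all of whose geodesic triangles are
`δ`-slim. -/
def IsHyperbolicSpace (δ : ℝ) (S : Type u) [MetricSpace S] : Prop :=
  (∀ x y : S, ∃ p : ArcPath S, p.IsGeodesic x y) ∧
  ∀ (x y z : S) (p q r : ArcPath S),
    p.IsGeodesic x y → q.IsGeodesic y z → r.IsGeodesic z x →
      p.image ⊆ nbhd (q.image ∪ r.image) δ ∧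
      q.image ⊆ nbhd (r.image ∪ p.image) δ ∧
      r.image ⊆ nbhd (p.image ∪ q.image) δ

/-! ### Translation length -/

/-- The translation length `lim d(x, fⁿ x) / n` of an isometry `f`, computed at some point `x`;
see `tendsto_translationLength` for the existence of the limit and its independence of `x`. -/
def translationLength {S : Type u} [MetricSpace S] [Nonempty S] (f : S → S) : ℝ :=
  limUnder atTop
    (fun n : ℕ => dist (Classical.arbitrary S) (f^[n] (Classical.arbitrary S)) / n)

theorem tendsto_translationLength {S : Type u} [MetricSpace S] [Nonempty S] (f : S → S)
    (hf : Isometry f) (x : S) :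
    Tendsto (fun n : ℕ => dist x (f^[n] x) / n) atTop (𝓝 (translationLength f)) := by
  have hiter : ∀ n : ℕ, Isometry (f^[n]) := by
    intro n
    induction n with
    | zero => exact isometry_id
    | succ n ih => rw [Function.iterate_succ]; exact ih.comp hf
  set y : S := Classical.arbitrary S with hy
  have hsub : Subadditive (fun n : ℕ => dist y (f^[n] y)) := by
    intro m n
    calc dist y (f^[m + n] y) ≤ dist y (f^[m] y) + dist (f^[m] y) (f^[m + n] y) :=
          dist_triangle _ _ _
      _ = _ := by rw [Function.iterate_add_apply, (hiter m).dist_eq]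
  have hbdd : BddBelow (Set.range fun n : ℕ => dist y (f^[n] y) / n) :=
    ⟨0, by rintro _ ⟨n, rfl⟩; positivity⟩
  have h1 := hsub.tendsto_lim hbdd
  have h2 : Tendsto (fun n : ℕ => dist y (f^[n] y) / n) atTop (𝓝 (translationLength f)) :=
    tendsto_nhds_limUnder ⟨_, h1⟩
  have h3 : Tendsto (fun n : ℕ => (2 * dist x y) / (n : ℝ)) atTop (𝓝 0) :=
    tendsto_const_div_atTop_nhds_zero_nat _
  refine (tendsto_iff_of_dist ?_).1 h2
  refine squeeze_zero (fun _ => dist_nonneg) (fun n => ?_) h3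
  rw [Real.dist_eq, ← sub_div, abs_div, Nat.abs_cast]
  gcongr
  have hd : dist (f^[n] x) (f^[n] y) = dist x y := (hiter n).dist_eq x y
  have a1 := dist_triangle4 y x (f^[n] x) (f^[n] y)
  have a2 := dist_triangle4 x y (f^[n] y) (f^[n] x)
  rw [dist_comm (f^[n] y), hd] at a2
  rw [dist_comm y x, hd] at a1
  rw [abs_le]
  constructor <;> linarith

/-- `x` almost minimises the displacement of `f`:
`d(x, f x) - inf_z d(z, f z) ≤ δ`. -/
def IsAlmostMinimal {S : Type u} [MetricSpace S] (δ : ℝ) (f : S → S) (x : S) : Prop :=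
  dist x (f x) - ⨅ z : S, dist z (f z) ≤ δ

/-- `T` and `K` are admissible constants for `δ`: in every `δ`-hyperbolic space, the orbit of an
almost minimally displaced point under an isometry `f` of translation length `τ ≥ T` satisfies
`i τ ≤ d(x, fⁱ x) ≤ i τ + K` for all `i ≥ 0`. -/
def AdmissibleConstants (δ T K : ℝ) : Prop :=
  0 < T ∧ 0 < K ∧
  ∀ (S : Type u) [MetricSpace S] [Nonempty S], IsHyperbolicSpace δ S →
    ∀ f : S ≃ᵢ S, T ≤ translationLength f →
      ∀ x : S, IsAlmostMinimal δ f x →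
        ∀ i : ℕ, i * translationLength f ≤ dist x (f^[i] x) ∧
          dist x (f^[i] x) ≤ i * translationLength f + K

/-! ### Group actions -/

/-- The translation length of `g ∈ Γ` acting on `S`. -/
def actionLength {Γ : Type v} [Group Γ] (S : Type u) [MetricSpace S] [Nonempty S] [MulAction Γ S]
    (g : Γ) : ℝ :=
  translationLength (fun x : S => g • x)

/-- `g` acts on `S` as a loxodromic isometry. -/
def IsLoxodromic {Γ : Type v} [Group Γ] (S : Type u) [MetricSpace S] [Nonempty S] [MulAction Γ S]
    (g : Γ) : Prop :=
  0 < actionLength S g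

/-- The action of `Γ` on `S` is acylindrical with parameters `R, N`. -/
def IsAcylindricalWith (Γ : Type v) [Group Γ] (S : Type u) [MetricSpace S] [MulAction Γ S]
    (R : ℝ → ℝ) (N : ℝ → ℕ) : Prop :=
  ∀ r : ℝ, 0 < r → 0 < R r ∧ 0 < N r ∧
    ∀ x x' : S, R r ≤ dist x x' →
      {g : Γ | dist x (g • x) ≤ r ∧ dist x' (g • x') ≤ r}.encard ≤ N r

/-- `a` is achiral: some power `a ^ m`, `m > 0`, is conjugate to its inverse. -/
def IsAchiral {Γ : Type v} [Group Γ] (a : Γ) : Prop :=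
  ∃ m : ℕ, 0 < m ∧ IsConj (a ^ m) (a ^ m)⁻¹

def IsChiral {Γ : Type v} [Group Γ] (a : Γ) : Prop :=
  ¬ IsAchiral a

/-! ### Epstein–Fujiwara counting functions -/

section Counting

variable (Γ : Type v) [Group Γ] {S : Type u} [MetricSpace S] [MulAction Γ S]

/-- The subpath of `α` on the parameter interval `[t, t + |w|]` is an (oriented) copy `a w` of `w`,
for some `a ∈ Γ`. -/
def IsCopyAt (w α : ArcPath S) (t : ℝ) : Prop :=
  0 ≤ t ∧ t + w.len ≤ α.len ∧
    ∃ a : Γ, ∀ s ∈ Set.Icc 0 w.len, α.toFun (t + s) = a • w.toFun s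

/-- `|α|_w`: the maximal number of non-overlapping oriented copies of `w` among the subpaths of
`α` (for `w` of positive length). Copies are recorded by their starting times; two subpaths of
length `|w|` are non-overlapping if these differ by at least `|w|`. -/
def copyCount (w α : ArcPath S) : ℕ :=
  sSup {n : ℕ | ∃ F : Finset ℝ, F.card = n ∧ (∀ t ∈ F, IsCopyAt Γ w α t) ∧
    ∀ t ∈ F, ∀ t' ∈ F, t ≠ t' → w.len ≤ |t - t'|}

/-- `c_{w,W}([x,y]) = d(x,y) - inf_α (|α| - W |α|_w)`, with `α` ranging over the paths from `x` to
`y` (of finite length; the others do not contribute to the infimum). -/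
def countFun (w : ArcPath S) (W : ℝ) (x y : S) : ℝ :=
  dist x y - sInf {v : ℝ | ∃ α : ArcPath S, α.source = x ∧ α.target = y ∧
    v = α.len - W * copyCount Γ w α}

/-- The Epstein–Fujiwara function `h_{w,W,x₀}`. -/
def efFun (w : ArcPath S) (W : ℝ) (x₀ : S) (a : Γ) : ℝ :=
  countFun Γ w W x₀ (a • x₀) - countFun Γ w.reverse W x₀ (a • x₀)

end Counting

/-- The homogenization `lim ψ(gⁿ) / n` (meaningful where the limit exists). -/
def homogenization {Γ : Type v} [Group Γ] (ψ : Γ → ℝ) (g : Γ) : ℝ :=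
  limUnder atTop (fun n : ℕ => ψ (g ^ n) / n)

end AcylGap

end

universe u v

open AcylGap

/-!
Write `W = K + 1` and let `w` be the geodesic from `x₀` to `g ^ M x₀`. Rebating each copy of `w` by
`W` turns the distance into a weighted distance, and the homogenization of `h_{g ^ M}` at `g` is the
growth rate along `⟨g⟩ x₀` of the weighted distance for the reverse of `w`, minus the growth rate
of the one for `w`.

Concatenating the translates `g ^ (M i) w` for `i < n` joins `x₀` to `g ^ (M n) x₀` at a cost of
`|w| - W` each. As `x₀` is almost minimal for `g ^ M`, `|w| ≤ M τ(g) + K`, so the growth rate for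
`w` is at most `τ(g) - 1 / M`.

The growth rate for the reverse of `w` is at least `τ(g)`, because a path from `x₀` to `g ^ n x₀`
gains nothing from the copies of the reverse of `w`: such a copy makes a progress of at most
`|w| - W` towards `g ^ n x₀`, so it wastes at least the `W` that it is rebated. Otherwise some
translate `a ⟨g⟩ x₀` of the axis would run backwards along the axis for a length comparable to
`|w|`. Then every `a g ^ j a⁻¹ g ^ j` with `j` small almost fixes two distant points of the axis;
by acylindricity two of these elements coincide for `M` large, so that `a` conjugates a positive
power of `g` to its inverse, which is excluded by chirality.
-/

namespace AcylGap

/-! ### Slim triangles and the four-point condition -/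

section PseudoMetric

variable {S : Type u} [PseudoMetricSpace S]

/-- Gromov's four-point condition, with its error normalised so that a tree satisfies it with
`e = 0`: of the three sums of opposite distances of a quadruple, the largest exceeds the second
largest by at most `e`. -/
def IsGromovHyperbolic (e : ℝ) (S : Type u) [PseudoMetricSpace S] : Prop :=
  ∀ x y z w : S, dist x y + dist z w ≤ max (dist x z + dist y w) (dist x w + dist y z) + e

theorem IsGromovHyperbolic.le_or_le {e : ℝ} (hS : IsGromovHyperbolic e S) (x y z w : S) :
    dist x y + dist z w ≤ dist x z + dist y w + e ∨
      dist x y + dist z w ≤ dist x w + dist y z + e := by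
  simpa only [← max_add_add_right, le_max_iff] using hS x y z w

theorem IsGromovHyperbolic.nonneg [Nonempty S] {e : ℝ} (hS : IsGromovHyperbolic e S) : 0 ≤ e := by
  inhabit S
  simpa using hS default default default default

end PseudoMetric

namespace ArcPath.IsGeodesic

variable {S : Type u} [MetricSpace S] {p : ArcPath S} {x y : S}

theorem dist_left (h : p.IsGeodesic x y) {t : ℝ} (ht : t ∈ Set.Icc 0 p.len) :
    dist x (p.toFun t) = t := by
  rw [← h.1, source, h.2.2 0 ⟨le_rfl, p.len_nonneg⟩ t ht, zero_sub, abs_neg, abs_of_nonneg ht.1]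

theorem dist_right (h : p.IsGeodesic x y) {t : ℝ} (ht : t ∈ Set.Icc 0 p.len) :
    dist (p.toFun t) y = p.len - t := by
  rw [← h.2.1, target, h.2.2 t ht p.len ⟨p.len_nonneg, le_rfl⟩, abs_sub_comm,
    abs_of_nonneg (sub_nonneg.2 ht.2)]

theorem len_eq (h : p.IsGeodesic x y) : p.len = dist x y := by
  rw [← h.dist_left ⟨p.len_nonneg, le_rfl⟩]
  exact congrArg (dist x) h.2.1

theorem dist_add_dist (h : p.IsGeodesic x y) {z : S} (hz : z ∈ p.image) :
    dist x z + dist z y = dist x y := by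
  obtain ⟨t, ht, rfl⟩ := hz
  rw [h.dist_left ht, h.dist_right ht, ← h.len_eq, add_sub_cancel]

theorem continuousOn (h : p.IsGeodesic x y) : ContinuousOn p.toFun (Set.Icc 0 p.len) := by
  refine LipschitzOnWith.continuousOn (K := 1) (LipschitzOnWith.of_dist_le_mul fun s hs t ht => ?_)
  rw [h.2.2 s hs t ht, Real.dist_eq, NNReal.coe_one, one_mul]

theorem isCompact_image (h : p.IsGeodesic x y) : IsCompact p.image :=
  isCompact_Icc.image_of_continuousOn h.continuousOn

theorem isPreconnected_image (h : p.IsGeodesic x y) : IsPreconnected p.image :=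
  isPreconnected_Icc.image _ h.continuousOn

theorem left_mem_image (h : p.IsGeodesic x y) : x ∈ p.image :=
  ⟨0, ⟨le_rfl, p.len_nonneg⟩, h.1⟩

theorem right_mem_image (h : p.IsGeodesic x y) : y ∈ p.image :=
  ⟨p.len, ⟨p.len_nonneg, le_rfl⟩, h.2.1⟩

end ArcPath.IsGeodesic

section SlimTriangles

variable {S : Type u} [MetricSpace S]

theorem isClosed_nbhd (A : Set S) (r : ℝ) : IsClosed (nbhd A r) :=
  isClosed_le (Metric.continuous_infDist_pt A) continuous_const

theorem subset_nbhd (A : Set S) {r : ℝ} (hr : 0 ≤ r) : A ⊆ nbhd A r := fun _ hx =>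
  (Metric.infDist_zero_of_mem hx).trans_le hr

theorem exists_dist_le_of_mem_nbhd {A : Set S} (hA : IsCompact A) (hne : A.Nonempty) {r : ℝ}
    {x : S} (hx : x ∈ nbhd A r) : ∃ z ∈ A, dist x z ≤ r := by
  obtain ⟨z, hz, h⟩ := hA.exists_infDist_eq_dist hne x
  exact ⟨z, hz, h ▸ hx⟩

namespace IsHyperbolicSpace

variable {δ : ℝ} {x y z : S} {p q r : ArcPath S}

theorem exists_dist_le_of_mem_image (hS : IsHyperbolicSpace δ S) (hp : p.IsGeodesic x y)
    (hq : q.IsGeodesic y z) (hr : r.IsGeodesic z x) {c : S} (hc : c ∈ p.image) :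
    ∃ a ∈ q.image ∪ r.image, dist c a ≤ δ :=
  exists_dist_le_of_mem_nbhd (hq.isCompact_image.union hr.isCompact_image)
    ⟨y, Or.inl hq.left_mem_image⟩ ((hS.2 x y z p q r hp hq hr).1 hc)

/-- The two neighbourhoods cover the connected side `p`, hence they meet on it. -/
theorem exists_mem_image_dist_le_dist_le (hδ : 0 ≤ δ) (hS : IsHyperbolicSpace δ S)
    (hp : p.IsGeodesic x y) (hq : q.IsGeodesic y z) (hr : r.IsGeodesic z x) :
    ∃ c ∈ p.image, (∃ a ∈ q.image, dist c a ≤ δ) ∧ ∃ b ∈ r.image, dist c b ≤ δ := by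
  have hcover : p.image ⊆ nbhd q.image δ ∪ nbhd r.image δ := fun c hc => by
    obtain ⟨a, ha | ha, hd⟩ := hS.exists_dist_le_of_mem_image hp hq hr hc
    · exact Or.inl ((Metric.infDist_le_dist_of_mem ha).trans hd)
    · exact Or.inr ((Metric.infDist_le_dist_of_mem ha).trans hd)
  obtain ⟨c, hc, hcq, hcr⟩ := isPreconnected_closed_iff.1 hp.isPreconnected_image _ _
    (isClosed_nbhd q.image δ) (isClosed_nbhd r.image δ) hcover
    ⟨y, hp.right_mem_image, subset_nbhd _ hδ hq.left_mem_image⟩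
    ⟨x, hp.left_mem_image, subset_nbhd _ hδ hr.right_mem_image⟩
  exact ⟨c, hc, exists_dist_le_of_mem_nbhd hq.isCompact_image ⟨y, hq.left_mem_image⟩ hcq,
    exists_dist_le_of_mem_nbhd hr.isCompact_image ⟨x, hr.right_mem_image⟩ hcr⟩

theorem exists_mem_image_two_mul_dist_le (hδ : 0 ≤ δ) (hS : IsHyperbolicSpace δ S)
    (hp : p.IsGeodesic x y) (w : S) :
    ∃ c ∈ p.image, 2 * dist w c ≤ dist w x + dist w y - dist x y + 4 * δ := by
  obtain ⟨q, hq⟩ := hS.1 y w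
  obtain ⟨r, hr⟩ := hS.1 w x
  obtain ⟨c, hc, ⟨a, ha, hca⟩, b, hb, hcb⟩ :=
    hS.exists_mem_image_dist_le_dist_le hδ hp hq hr
  refine ⟨c, hc, ?_⟩
  have hxy := hp.dist_add_dist hc
  have hyw := hq.dist_add_dist ha
  have hwx := hr.dist_add_dist hb
  have hya := dist_triangle y a c
  have haw := dist_triangle c a w
  have hwb := dist_triangle w b c
  have hbx := dist_triangle c b x
  simp only [dist_comm a c, dist_comm b c, dist_comm c y, dist_comm c w, dist_comm c x,
    dist_comm y w] at *
  linarith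

theorem isGromovHyperbolic (hδ : 0 ≤ δ) (hS : IsHyperbolicSpace δ S) :
    IsGromovHyperbolic (6 * δ) S := by
  intro x z w y
  obtain ⟨p, hp⟩ := hS.1 x z
  obtain ⟨q, hq⟩ := hS.1 z y
  obtain ⟨r, hr⟩ := hS.1 y x
  obtain ⟨a, ha, hwa⟩ := hS.exists_mem_image_two_mul_dist_le hδ hp w
  obtain ⟨b, hb, hab⟩ := hS.exists_dist_le_of_mem_image hp hq hr ha
  have hwb := dist_triangle w a b
  have hwbx := dist_triangle_right w x b
  have hwby := dist_triangle_right w y b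
  have hwbz := dist_triangle_right w z b
  rw [← max_add_add_right, le_max_iff, dist_comm x w, dist_comm z w, dist_comm x y]
  rcases hb with hb | hb
  · have hzy := hq.dist_add_dist hb
    rw [dist_comm b y] at hzy
    left; linarith
  · have hyx := hr.dist_add_dist hb
    rw [dist_comm b x] at hyx
    right; linarith

theorem exists_midpoint (hS : IsHyperbolicSpace δ S) (x y : S) :
    ∃ m : S, dist x m = dist x y / 2 ∧ dist m y = dist x y / 2 := by
  obtain ⟨p, hp⟩ := hS.1 x y
  have hmid : p.len / 2 ∈ Set.Icc 0 p.len :=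
    ⟨div_nonneg p.len_nonneg zero_le_two, half_le_self p.len_nonneg⟩
  refine ⟨p.toFun (p.len / 2), ?_, ?_⟩
  · rw [hp.dist_left hmid, hp.len_eq]
  · rw [hp.dist_right hmid, hp.len_eq, sub_half]

end IsHyperbolicSpace

end SlimTriangles

/-! ### Translation length -/

theorem mul_le_of_subadditive_of_tendsto {u : ℕ → ℝ} (hu : Subadditive u) {l : ℝ}
    (h : Tendsto (fun n : ℕ => u n / n) atTop (𝓝 l)) (n : ℕ) : n * l ≤ u n := by
  rcases n.eq_zero_or_pos with rfl | hn
  · simpa using hu 0 0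
  have hbdd := h.bddBelow_range
  rw [← le_div_iff₀' (Nat.cast_pos.2 hn), tendsto_nhds_unique h (hu.tendsto_lim hbdd)]
  exact hu.lim_le_div hbdd hn.ne'

section Iterate

variable {S : Type u} [PseudoMetricSpace S] {f : S → S}

theorem isometry_iterate (hf : Isometry f) : ∀ n : ℕ, Isometry (f^[n])
  | 0 => isometry_id
  | n + 1 => (isometry_iterate hf n).comp hf

theorem dist_iterate_add (hf : Isometry f) (x : S) (i j : ℕ) :
    dist (f^[i] x) (f^[i + j] x) = dist x (f^[j] x) := by
  rw [Function.iterate_add_apply, (isometry_iterate hf i).dist_eq]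

theorem subadditive_dist_iterate (hf : Isometry f) (x : S) :
    Subadditive (fun n : ℕ => dist x (f^[n] x)) := fun m n =>
  (dist_triangle _ (f^[m] x) _).trans_eq (by rw [dist_iterate_add hf])

end Iterate

section TranslationLength

variable {S : Type u} [MetricSpace S] [Nonempty S] {f : S → S}

theorem mul_translationLength_le (hf : Isometry f) (x : S) (n : ℕ) :
    n * translationLength f ≤ dist x (f^[n] x) :=
  mul_le_of_subadditive_of_tendsto (subadditive_dist_iterate hf x)
    (tendsto_translationLength f hf x) n

theorem translationLength_le_dist (hf : Isometry f) (x : S) :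
    translationLength f ≤ dist x (f x) := by
  simpa using mul_translationLength_le hf x 1

theorem translationLength_nonneg (hf : Isometry f) : 0 ≤ translationLength f := by
  inhabit S
  exact ge_of_tendsto' (tendsto_translationLength f hf default) fun n => by positivity

theorem translationLength_iterate (hf : Isometry f) (k : ℕ) :
    translationLength (f^[k]) = k * translationLength f := by
  inhabit S
  rcases k.eq_zero_or_pos with rfl | hk
  · have h := tendsto_translationLength (f^[0]) (isometry_iterate hf 0) default
    simp only [Function.iterate_zero, Function.iterate_id, id, dist_self, zero_div] at h
    simpa using tendsto_nhds_unique h tendsto_const_nhds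
  have hk' : (k : ℝ) ≠ 0 := Nat.cast_ne_zero.2 hk.ne'
  refine tendsto_nhds_unique (tendsto_translationLength (f^[k]) (isometry_iterate hf k) default)
    ((((tendsto_translationLength f hf default).comp
      (tendsto_id.nsmul_atTop hk)).const_mul (k : ℝ)).congr fun n => ?_)
  simp only [Function.comp_apply, id, smul_eq_mul, Nat.cast_mul, ← Function.iterate_mul]
  rw [mul_div_assoc', mul_div_mul_left _ _ hk']

/-- The sequence `K - d(x, fⁿ x)` is subadditive, with slope minus the translation length. -/
theorem dist_iterate_le_of_superadditive (hf : Isometry f) {x : S} {K : ℝ}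
    (h : ∀ i j : ℕ, dist x (f^[i] x) + dist x (f^[j] x) ≤ dist x (f^[i + j] x) + K) (i : ℕ) :
    dist x (f^[i] x) ≤ i * translationLength f + K := by
  have hsub : Subadditive fun n : ℕ => K - dist x (f^[n] x) := fun i j => by
    linarith [h i j]
  have hlim : Tendsto (fun n : ℕ => (K - dist x (f^[n] x)) / n) atTop
      (𝓝 (-translationLength f)) := by
    simpa only [sub_div, zero_sub] using
      (tendsto_const_div_atTop_nhds_zero_nat K).sub (tendsto_translationLength f hf x)
  linarith [mul_le_of_subadditive_of_tendsto hsub hlim i]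

end TranslationLength

/-! ### From local to global progress -/

section LocalToGlobal

variable {e c : ℝ}

theorem IsGromovHyperbolic.dist_iterate_add_le_dist_iterate_succ {S : Type u} [PseudoMetricSpace S]
    (hS : IsGromovHyperbolic e S) {f : S → S} (hf : Isometry f) {x : S}
    (hlong : c + 2 * e < dist x (f x)) (h2 : 2 * dist x (f x) - c ≤ dist x (f (f x))) (i : ℕ) :
    dist x (f^[i] x) + dist x (f x) ≤ dist x (f^[i + 1] x) + (c + e) := by
  have : Nonempty S := ⟨x⟩
  have he := hS.nonneg
  induction i with
  | zero =>
    have := dist_triangle x (f x) (f (f x))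
    rw [hf.dist_eq] at this
    simp only [Function.iterate_zero, id, dist_self, zero_add, Function.iterate_one]
    linarith
  | succ i ih =>
    have h01 : dist (f^[i] x) (f^[i + 1] x) = dist x (f x) := dist_iterate_add hf x i 1
    have h12 : dist (f^[i + 1] x) (f^[i + 1 + 1] x) = dist x (f x) :=
      dist_iterate_add hf x (i + 1) 1
    have h02 : dist (f^[i] x) (f^[i + 1 + 1] x) = dist x (f (f x)) := dist_iterate_add hf x i 2
    rcases hS.le_or_le x (f^[i + 1] x) (f^[i] x) (f^[i + 1 + 1] x) with h | h
    · linarith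
    · rw [dist_comm (f^[i + 1] x)] at h
      linarith

theorem IsGromovHyperbolic.dist_iterate_add_dist_iterate_le {S : Type u} [PseudoMetricSpace S]
    (hS : IsGromovHyperbolic e S) {f : S → S} (hf : Isometry f) {x : S}
    (hlong : c + 2 * e < dist x (f x)) (h2 : 2 * dist x (f x) - c ≤ dist x (f (f x))) (i j : ℕ) :
    dist x (f^[i] x) + dist x (f^[j] x) ≤ dist x (f^[i + j] x) + (c + 2 * e) := by
  have hstep := hS.dist_iterate_add_le_dist_iterate_succ hf hlong h2
  have : Nonempty S := ⟨x⟩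
  have he := hS.nonneg
  rcases j with _ | j
  · have := hstep 0
    simp only [Function.iterate_zero, id, dist_self, zero_add, Function.iterate_one,
      add_zero] at this ⊢
    linarith
  have h01 : dist (f^[i] x) (f^[i + 1] x) = dist x (f x) := dist_iterate_add hf x i 1
  have h0j := dist_iterate_add hf x i (j + 1)
  have h1j := dist_iterate_add hf x (i + 1) j
  rw [add_right_comm, add_assoc] at h1j
  rcases hS.le_or_le x (f^[i + 1] x) (f^[i] x) (f^[i + (j + 1)] x) with h | h
  · linarith [hstep i, hstep j]
  · rw [dist_comm (f^[i + 1] x)] at h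
    linarith [hstep i, hstep j]

variable {S : Type u} [MetricSpace S] [Nonempty S]

theorem IsGromovHyperbolic.dist_iterate_le (hS : IsGromovHyperbolic e S) {f : S → S}
    (hf : Isometry f) {x : S} (hlong : c + 2 * e < dist x (f x))
    (h2 : 2 * dist x (f x) - c ≤ dist x (f (f x))) (i : ℕ) :
    dist x (f^[i] x) ≤ i * translationLength f + (c + 2 * e) :=
  dist_iterate_le_of_superadditive hf (hS.dist_iterate_add_dist_iterate_le hf hlong h2) i

end LocalToGlobal

section AlmostMinimal

variable {δ : ℝ} {S : Type u} [MetricSpace S] {f : S → S} {x : S}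

theorem IsAlmostMinimal.dist_le (hx : IsAlmostMinimal δ f x) (z : S) :
    dist x (f x) ≤ dist z (f z) + δ := by
  have hinf : ⨅ z : S, dist z (f z) ≤ dist z (f z) :=
    ciInf_le ⟨0, by rintro _ ⟨z, rfl⟩; exact dist_nonneg⟩ z
  have : dist x (f x) - ⨅ z : S, dist z (f z) ≤ δ := hx
  linarith

theorem exists_isAlmostMinimal [Nonempty S] (hδ : 0 < δ) (f : S → S) :
    ∃ x : S, IsAlmostMinimal δ f x := by
  obtain ⟨x, hx⟩ := exists_lt_of_ciInf_lt (lt_add_of_pos_right (⨅ z : S, dist z (f z)) hδ)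
  exact ⟨x, (sub_lt_iff_lt_add'.2 hx).le⟩

/-- Were the path through `x`, `f x`, `f (f x)` to backtrack, the midpoint of `x` and `f x` would be
displaced by much less than `x`. -/
theorem IsHyperbolicSpace.two_mul_dist_sub_le (hδ : 0 ≤ δ) (hS : IsHyperbolicSpace δ S)
    (hf : Isometry f) (hx : IsAlmostMinimal δ f x) (hlong : 13 * δ < dist x (f x)) :
    2 * dist x (f x) - 13 * δ ≤ dist x (f (f x)) := by
  obtain ⟨m, hxm, hmx⟩ := hS.exists_midpoint x (f x)
  have hmin := hx.dist_le m
  have hfxm : dist (f x) (f m) = dist x (f x) / 2 := by rw [hf.dist_eq, hxm]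
  have hfmx : dist (f m) (f (f x)) = dist x (f x) / 2 := by rw [hf.dist_eq, hmx]
  have hff : dist (f x) (f (f x)) = dist x (f x) := hf.dist_eq _ _
  have hbacktrack := (hS.isGromovHyperbolic hδ).le_or_le x (f m) (f x) (f (f x))
  have hmid := (hS.isGromovHyperbolic hδ).le_or_le m (f m) x (f x)
  rw [dist_comm (f m) (f x)] at hbacktrack hmid
  rw [dist_comm m x, dist_comm (f m) x] at hmid
  rcases hbacktrack with hbacktrack | hbacktrack <;> rcases hmid with hmid | hmid <;> linarith

end AlmostMinimal

theorem exists_admissibleConstants {δ : ℝ} (hδ : 0 < δ) :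
    ∃ T K : ℝ, AdmissibleConstants.{u} δ T K := by
  refine ⟨26 * δ, 25 * δ, by positivity, by positivity, ?_⟩
  intro S _ _ hS f hT x hx i
  have hf : Isometry f := f.isometry
  have hlong := hT.trans (translationLength_le_dist hf x)
  have h2 := hS.two_mul_dist_sub_le hδ.le hf hx (by linarith)
  refine ⟨mul_translationLength_le hf x i, ?_⟩
  convert (hS.isGromovHyperbolic hδ.le).dist_iterate_le hf (c := 13 * δ) (by linarith) h2 i using 2
  ring

/-! ### Rough rays -/

section RoughRays

variable {S : Type u} [PseudoMetricSpace S]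

/-- A sequence moving at speed `τ` towards infinity along a geodesic, up to the additive error
`C`. The error is one-sided because this is how orbits of isometries behave; `τ` is then the exact
speed. -/
structure IsRoughRay (γ : ℕ → S) (τ C : ℝ) : Prop where
  mul_le_dist : ∀ i j : ℕ, j * τ ≤ dist (γ i) (γ (i + j))
  dist_le : ∀ i j : ℕ, dist (γ i) (γ (i + j)) ≤ j * τ + C

namespace IsRoughRay

variable {γ : ℕ → S} {τ C : ℝ}

theorem nonneg (hγ : IsRoughRay γ τ C) : 0 ≤ C := by
  simpa using hγ.dist_le 0 0

theorem mul_le_dist_zero (hγ : IsRoughRay γ τ C) (n : ℕ) : n * τ ≤ dist (γ 0) (γ n) := by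
  simpa only [zero_add] using hγ.mul_le_dist 0 n

theorem dist_zero_le (hγ : IsRoughRay γ τ C) (n : ℕ) : dist (γ 0) (γ n) ≤ n * τ + C := by
  simpa only [zero_add] using hγ.dist_le 0 n

theorem smul {G : Type v} [SMul G S] [IsIsometricSMul G S] (hγ : IsRoughRay γ τ C) (a : G) :
    IsRoughRay (fun n => a • γ n) τ C where
  mul_le_dist i j := by simpa only [dist_smul] using hγ.mul_le_dist i j
  dist_le i j := by simpa only [dist_smul] using hγ.dist_le i j

end IsRoughRay

namespace IsGromovHyperbolic

variable {e : ℝ} (hS : IsGromovHyperbolic e S)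
include hS

theorem dist_le_abs_sub_of_between {u v y z : S} {κ : ℝ}
    (hy : dist u y + dist y v ≤ dist u v + κ) (hz : dist u z + dist z v ≤ dist u v + κ) :
    dist y z ≤ |dist u y - dist u z| + (κ + e) := by
  rcases hS.le_or_le u v y z with h | h
  · rw [dist_comm v z] at h
    linarith [le_abs_self (dist u y - dist u z)]
  · rw [dist_comm v y] at h
    linarith [neg_le_abs (dist u y - dist u z)]

theorem between_of_dist_lt {p p' q y : S} {κ : ℝ} (hy : dist p y + dist y q ≤ dist p q + κ)
    (hpp' : 2 * dist p p' + κ + e < 2 * dist p y) :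
    dist p' y + dist y q ≤ dist p' q + (κ + e) := by
  have := dist_triangle p p' y
  rcases hS.le_or_le p q p' y with h | h
  · rw [dist_comm q y] at h
    linarith
  · rw [dist_comm q p'] at h
    linarith

theorem dist_le_abs_sub_add_of_between {h : S → S} (hh : Isometry h) {u x v : S} {κ : ℝ}
    (hx : dist u x + dist x v ≤ dist u v + κ)
    (hu : dist u (h u) ≤ dist x (h x)) (hv : dist v (h v) ≤ dist x (h x))
    (hux : 2 * dist x (h x) + κ + 2 * e < 2 * dist u x)
    (hxv : 2 * dist x (h x) + κ + 2 * e < 2 * dist x v) :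
    dist x (h x) ≤ |dist u x - dist u (h x)| + (κ + 3 * e) := by
  have : Nonempty S := ⟨x⟩
  have he := hS.nonneg
  have hhx : dist (h u) (h x) + dist (h x) (h v) ≤ dist (h u) (h v) + κ := by
    simpa only [hh.dist_eq] using hx
  have hleft := hS.between_of_dist_lt (p' := u) hhx (by
    rw [dist_comm (h u), hh.dist_eq]
    linarith)
  rw [add_comm (dist u (h x)), dist_comm (h x), dist_comm u (h x), dist_comm u (h v)] at hleft
  have hright := hS.between_of_dist_lt (p' := v) hleft (by
    rw [dist_comm (h v) v, dist_comm (h v) (h x), hh.dist_eq]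
    linarith)
  rw [add_comm (dist v (h x)), dist_comm (h x), dist_comm v (h x), dist_comm v u] at hright
  have := hS.dist_le_abs_sub_of_between (u := u) (v := v) (y := x) (z := h x) (κ := κ + 2 * e)
    (by linarith) (by linarith)
  linarith

/-- Far from the endpoints, `h` translates along the geodesic from `u` to `v`, either towards `v`
or towards `u`. -/
theorem two_mul_dist_sub_le_of_between {h : S → S} (hh : Isometry h) {u x v : S} {κ : ℝ}
    (hx : dist u x + dist x v ≤ dist u v + κ)
    (hu : dist u (h u) ≤ dist x (h x)) (hv : dist v (h v) ≤ dist x (h x))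
    (hux : 2 * dist x (h x) + κ + 2 * e < dist u x)
    (hxv : 2 * dist x (h x) + κ + 2 * e < dist x v) :
    2 * dist x (h x) - (2 * κ + 7 * e) ≤ dist x (h (h x)) := by
  have : Nonempty S := ⟨x⟩
  have he := hS.nonneg
  have hκ : 0 ≤ κ := by linarith [dist_triangle u x v]
  have hD : 0 ≤ dist x (h x) := dist_nonneg
  have hhux : dist (h u) (h x) = dist u x := hh.dist_eq _ _
  have hhxx : dist (h x) (h (h x)) = dist x (h x) := hh.dist_eq _ _
  have hhuhx : dist (h u) (h (h x)) = dist u (h x) := hh.dist_eq _ _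
  have hhu : dist (h u) u = dist u (h u) := dist_comm _ _
  have hshift := hS.dist_le_abs_sub_add_of_between hh hx hu hv (by linarith) (by linarith)
  rcases abs_cases (dist u x - dist u (h x)) with ⟨habs, -⟩ | ⟨habs, -⟩ <;> rw [habs] at hshift
  · have hnext := hS.between_of_dist_lt (p := h u) (p' := u) (y := h (h x)) (q := h x)
      (κ := κ + 3 * e) (by linarith [dist_comm (h (h x)) (h x)])
      (by linarith [dist_triangle_right u x (h x)])
    linarith [dist_triangle_right u x (h (h x)), dist_comm (h (h x)) (h x)]
  · have hnext := hS.between_of_dist_lt (p := h u) (p' := u) (y := h x) (q := h (h x))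
      (κ := κ + 3 * e) (by linarith) (by linarith)
    linarith [dist_triangle u x (h (h x))]

end IsGromovHyperbolic

end RoughRays

theorem IsGromovHyperbolic.dist_le_translationLength_add {S : Type u} [MetricSpace S] [Nonempty S]
    {e τ C D : ℝ} (hS : IsGromovHyperbolic e S) {γ : ℕ → S} (hτ : 0 < τ) (hγ : IsRoughRay γ τ C)
    {h : S → S} (hh : Isometry h) (hD : ∀ n, dist (γ n) (h (γ n)) = D) :
    D ≤ translationLength h + (4 * C + 9 * e) := by
  rcases le_or_gt D (4 * C + 9 * e) with hle | hlt
  · exact hle.trans (le_add_of_nonneg_left (translationLength_nonneg hh))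
  obtain ⟨n, hn⟩ := exists_nat_gt ((2 * D + 2 * C + 2 * e) / τ)
  rw [div_lt_iff₀ hτ] at hn
  have h0n := hγ.mul_le_dist_zero n
  have hn2n := hγ.mul_le_dist n n
  have hbetween : dist (γ 0) (γ n) + dist (γ n) (γ (n + n)) ≤ dist (γ 0) (γ (n + n)) + 2 * C := by
    have h0nn := hγ.mul_le_dist_zero (n + n)
    push_cast at h0nn
    linarith [hγ.dist_zero_le n, hγ.dist_le n n]
  have h2 := hS.two_mul_dist_sub_le_of_between hh hbetween (by rw [hD, hD]) (by rw [hD, hD])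
    (by rw [hD]; linarith) (by rw [hD]; linarith)
  have hglobal := hS.dist_iterate_le hh (x := γ n) (c := 4 * C + 7 * e) (by rw [hD]; linarith)
    (by linarith) 1
  rw [Function.iterate_one, hD, Nat.cast_one, one_mul] at hglobal
  linarith

/-! ### Acylindrical actions -/

section Action

variable {S : Type u} [MetricSpace S] {Γ : Type v} [Group Γ] [MulAction Γ S]

theorem IsAcylindricalWith.exists_lt_eq {R : ℝ → ℝ} {N : ℝ → ℕ} (hac : IsAcylindricalWith Γ S R N)
    {r : ℝ} (hr : 0 < r) {x x' : S} (hxx' : R r ≤ dist x x') {f : ℕ → Γ}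
    (hf : ∀ j ≤ N r, dist x (f j • x) ≤ r ∧ dist x' (f j • x') ≤ r) :
    ∃ i j, i < j ∧ f i = f j := by
  have hcard : {a : Γ | dist x (a • x) ≤ r ∧ dist x' (a • x') ≤ r}.encard <
      (Set.Iic (N r)).encard := by
    refine ((hac r hr).2.2 x x' hxx').trans_lt ?_
    rw [Set.encard_eq_coe_toFinset_card, Set.toFinset_Iic, Nat.card_Iic]
    exact_mod_cast Nat.lt_succ_self _
  obtain ⟨i, -, j, -, hij, h⟩ := Set.exists_ne_map_eq_of_encard_lt_of_maps_to hcard hf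
  rcases hij.lt_or_gt with hij | hij
  · exact ⟨i, j, hij, h⟩
  · exact ⟨j, i, hij, h.symm⟩

variable [IsIsometricSMul Γ S]

theorem dist_pow_smul_pow_smul (g : Γ) (x : S) (i j : ℕ) :
    dist (g ^ i • x) (g ^ (i + j) • x) = dist x (g ^ j • x) := by
  rw [pow_add, mul_smul, dist_smul]

theorem dist_pow_smul_smul (g : Γ) (x : S) {h : Γ} (hgh : Commute g h) (n : ℕ) :
    dist (g ^ n • x) (h • g ^ n • x) = dist x (h • x) := by
  rw [smul_smul, ← (hgh.pow_left n).eq, mul_smul, dist_smul]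

/-- A translation length below `1 / N (C + 1)` would give more than `N (C + 1)` powers of `g` that
move every point of the ray by at most `C + 1`. -/
theorem IsAcylindricalWith.one_le_mul_of_isRoughRay {R : ℝ → ℝ} {N : ℝ → ℕ}
    (hac : IsAcylindricalWith Γ S R N) {τ C : ℝ} (hτ : 0 < τ) {g : Γ} {x : S}
    (hγ : IsRoughRay (fun n => g ^ n • x) τ C) : 1 ≤ N (C + 1) * τ := by
  by_contra! hlt
  have hr : 0 < C + 1 := add_pos_of_nonneg_of_pos hγ.nonneg one_pos
  have hmem : ∀ n, ∀ j ≤ N (C + 1), dist (g ^ n • x) (g ^ j • g ^ n • x) ≤ C + 1 := by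
    intro n j hj
    have hjN : j * τ ≤ N (C + 1) * τ := by gcongr
    rw [dist_pow_smul_smul g x ((Commute.refl g).pow_right j), ← dist_pow_smul_pow_smul g x 0]
    linarith [hγ.dist_le 0 j]
  obtain ⟨n, hn⟩ := exists_nat_ge (R (C + 1) / τ)
  rw [div_le_iff₀ hτ] at hn
  obtain ⟨i, j, hij, heq⟩ := hac.exists_lt_eq hr (hn.trans (hγ.mul_le_dist_zero n))
    fun j hj => ⟨hmem 0 j hj, hmem n j hj⟩
  obtain ⟨k, rfl⟩ := Nat.exists_eq_add_of_lt hij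
  have hpos := (mul_pos (Nat.cast_pos.2 k.succ_pos) hτ).trans_le (hγ.mul_le_dist i (k + 1))
  rw [← add_assoc, ← heq, dist_self] at hpos
  exact hpos.false

variable [Nonempty S]

theorem mul_actionLength_le (g : Γ) (x : S) (n : ℕ) :
    n * actionLength S g ≤ dist x (g ^ n • x) := by
  simpa only [actionLength, smul_iterate_apply] using
    mul_translationLength_le (isometry_smul S g) x n

theorem actionLength_pow (g : Γ) (k : ℕ) : actionLength S (g ^ k) = k * actionLength S g := by
  rw [actionLength, actionLength, ← translationLength_iterate (isometry_smul S g), smul_iterate]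

theorem isRoughRay_pow_smul {g : Γ} {x : S} {C : ℝ}
    (h : ∀ n : ℕ, dist x (g ^ n • x) ≤ n * actionLength S g + C) :
    IsRoughRay (fun n => g ^ n • x) (actionLength S g) C where
  mul_le_dist i j := by
    simpa only [dist_pow_smul_pow_smul] using mul_actionLength_le g x j
  dist_le i j := by
    simpa only [dist_pow_smul_pow_smul] using h j

namespace AdmissibleConstants

variable {δ T K : ℝ} (h : AdmissibleConstants.{u} δ T K) (hS : IsHyperbolicSpace δ S)
include h hS

theorem isRoughRay_pow_smul {f : Γ} (hf : T ≤ actionLength S f) {x : S}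
    (hx : IsAlmostMinimal δ (fun z : S => f • z) x) :
    IsRoughRay (fun n => f ^ n • x) (actionLength S f) K :=
  AcylGap.isRoughRay_pow_smul fun n => by
    have hn := (h.2.2 S hS (IsometryEquiv.constSMul f) hf x hx n).2
    rwa [show (IsometryEquiv.constSMul f : S → S) = (f • ·) from rfl, smul_iterate_apply] at hn

/-- The powers of `g` commute with `g ^ M`, hence have constant displacement along its rough
axis. -/
theorem isRoughRay_pow_smul_of_pow (hδ : 0 ≤ δ) {g : Γ} {M : ℕ}
    (hM : T ≤ actionLength S (g ^ M)) {x : S}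
    (hx : IsAlmostMinimal δ (fun z : S => g ^ M • z) x) :
    IsRoughRay (fun n => g ^ n • x) (actionLength S g) (4 * K + 9 * (6 * δ)) :=
  AcylGap.isRoughRay_pow_smul fun n => by
    rw [← actionLength_pow]
    exact (hS.isGromovHyperbolic hδ).dist_le_translationLength_add (h.1.trans_le hM)
      (h.isRoughRay_pow_smul hS hM hx) (isometry_smul S (g ^ n))
      (dist_pow_smul_smul (g ^ M) x ((Commute.refl g).pow_pow M n))

theorem one_le_mul_actionLength (hδ : 0 < δ) {R : ℝ → ℝ} {N : ℝ → ℕ}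
    (hac : IsAcylindricalWith Γ S R N) {g : Γ} (hg : IsLoxodromic S g) :
    1 ≤ N (4 * K + 9 * (6 * δ) + 1) * actionLength S g := by
  obtain ⟨k, hk⟩ := exists_nat_ge (T / actionLength S g)
  rw [div_le_iff₀ hg, ← actionLength_pow] at hk
  obtain ⟨x, hx⟩ := exists_isAlmostMinimal hδ (fun z : S => g ^ k • z)
  exact hac.one_le_mul_of_isRoughRay hg (h.isRoughRay_pow_smul_of_pow hS hδ.le hk hx)

end AdmissibleConstants

end Action

/-! ### Translates of a rough axis that run backwards -/

section Reversal

variable {S : Type u} [PseudoMetricSpace S]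

/-- In a tree, the position of the projection of `z` to the segment from `x` to `y`, measured from
its midpoint in the direction of `y`. -/
noncomputable def projCoord (x y z : S) : ℝ := (dist x z - dist y z) / 2

theorem projCoord_right_sub_left (x y : S) : projCoord x y y - projCoord x y x = dist x y := by
  rw [projCoord, projCoord, dist_self, dist_self, dist_comm y x]
  ring

theorem projCoord_sub_le_dist (x y z z' : S) : projCoord x y z' - projCoord x y z ≤ dist z z' := by
  simp only [projCoord]
  linarith [dist_triangle x z z', dist_triangle_right y z z']

namespace IsGromovHyperbolic

variable {e : ℝ} (hS : IsGromovHyperbolic e S)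
include hS

theorem aligned_of_lt_projCoord_sub {W : ℝ} {x y p q : S}
    (hprog : dist p q - W < projCoord x y q - projCoord x y p) (hlong : 4 * W + e < 2 * dist p q) :
    dist x p + dist p q ≤ dist x q + 2 * W ∧ dist x q + dist q y ≤ dist x y + (2 * W + e) := by
  simp only [projCoord] at hprog
  have hy := dist_triangle_right y p q
  refine ⟨by linarith, ?_⟩
  rcases hS.le_or_le x q p y with h | h <;> rw [dist_comm p y] at h
  · linarith [dist_comm q y, dist_triangle x p q]
  · linarith [dist_comm q y, dist_comm q p, dist_triangle x p q]

/-- The hypotheses say that `η M`, `η 0` and `γ P` are almost in this order on a geodesic issued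
from `γ 0`. -/
theorem dist_le_of_antiparallel {γ η : ℕ → S} {τ C W : ℝ} {M P : ℕ}
    (hγ : IsRoughRay γ τ C) (hη : IsRoughRay η τ C) (hW : 0 ≤ W)
    (hstart : dist (γ 0) (η M) + M * τ ≤ dist (γ 0) (η 0) + 2 * W)
    (hend : dist (γ 0) (η 0) + dist (η 0) (γ P) ≤ dist (γ 0) (γ P) + (2 * W + e))
    {i k : ℕ} (hi : i ≤ P) (hk : k ≤ M) :
    dist (γ i) (η k) ≤ |i * τ - (dist (γ 0) (η M) + (M - k) * τ)| + (4 * W + 2 * C + 2 * e) := by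
  have : Nonempty S := ⟨γ 0⟩
  have he := hS.nonneg
  obtain ⟨m, rfl⟩ := Nat.exists_eq_add_of_le hk
  obtain ⟨p, rfl⟩ := Nat.exists_eq_add_of_le hi
  have habs := le_abs_self (i * τ - (dist (γ 0) (η (k + m)) + m * τ))
  have habs' := neg_le_abs (i * τ - (dist (γ 0) (η (k + m)) + m * τ))
  have hP := hγ.mul_le_dist_zero (i + p)
  push_cast at hstart hP ⊢
  rw [add_sub_cancel_left]
  rcases hS.le_or_le (γ 0) (γ (i + p)) (γ i) (η k) with h | h
  · linarith [hγ.dist_zero_le i, hη.dist_zero_le k,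
      dist_triangle_left (γ (i + p)) (η k) (η 0), dist_comm (γ (i + p)) (η 0)]
  · linarith [hγ.dist_le i p, hη.dist_le k m, dist_comm (γ (i + p)) (γ i),
      dist_triangle_right (γ 0) (η k) (η (k + m))]

theorem antiparallel_of_lt_projCoord_sub {γ η : ℕ → S} {τ C W : ℝ} {M P : ℕ}
    (hγ : IsRoughRay γ τ C) (hη : IsRoughRay η τ C) (hW : 0 ≤ W) (hlong : 4 * W + e < M * τ)
    (hprog : dist (η 0) (η M) - W <
      projCoord (γ 0) (γ P) (η 0) - projCoord (γ 0) (γ P) (η M)) :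
    dist (γ 0) (η M) + M * τ ≤ P * τ + (C + 4 * W + e) ∧
    ∀ i ≤ P, ∀ k ≤ M, dist (γ i) (η k) ≤
      |i * τ - (dist (γ 0) (η M) + (M - k) * τ)| + (4 * W + 2 * C + 2 * e) := by
  have : Nonempty S := ⟨γ 0⟩
  have he := hS.nonneg
  have hηM := hη.mul_le_dist_zero M
  rw [dist_comm] at hηM hprog
  obtain ⟨hstart, hend⟩ := hS.aligned_of_lt_projCoord_sub hprog (by linarith)
  refine ⟨?_, fun i hi k hk => hS.dist_le_of_antiparallel hγ hη hW (by linarith) hend hi hk⟩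
  linarith [hγ.dist_zero_le P, dist_nonneg (x := η 0) (y := γ P)]

theorem dist_le_of_dist_le_of_dist_le {u v z z' : S} {s t Q : ℝ} (hst : s + t ≤ dist u v)
    (huz : dist z u ≤ s + Q) (hzv : dist z v ≤ t + Q) (huz' : dist z' u ≤ s + Q)
    (hzv' : dist z' v ≤ t + Q) : dist z z' ≤ 2 * Q + e := by
  rcases hS.le_or_le u v z z' with h | h
  · linarith [dist_comm u z, dist_comm v z']
  · linarith [dist_comm u z', dist_comm v z]

end IsGromovHyperbolic

end Reversal

theorem isAchiral_of_conj_pow_mul_pow_eq {Γ : Type v} [Group Γ] {a g : Γ} {b c : ℕ} (hbc : b < c)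
    (h : a * g ^ b * a⁻¹ * g ^ b = a * g ^ c * a⁻¹ * g ^ c) : IsAchiral g := by
  obtain ⟨m, rfl⟩ := Nat.exists_eq_add_of_lt hbc
  refine ⟨m + 1, m.succ_pos, isConj_iff.2 ⟨a, ?_⟩⟩
  have hright : a * g ^ b * a⁻¹ = a * g ^ b * (g ^ (m + 1) * a⁻¹ * g ^ (m + 1)) :=
    mul_right_cancel (b := g ^ b) <| h.trans <| by
      simp only [mul_assoc, ← pow_add, mul_right_inj]
      simp only [← mul_assoc, ← pow_add, add_assoc, add_comm (m + 1)]
  have hleft : a⁻¹ = g ^ (m + 1) * a⁻¹ * g ^ (m + 1) := mul_left_cancel hright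
  rw [mul_assoc, eq_inv_iff_mul_eq_one, mul_assoc, ← hleft, mul_inv_cancel]

theorem exists_le_nat_mul_le_add {τ t : ℝ} (hτ : 0 < τ) (ht : 0 ≤ t) :
    ∃ n : ℕ, t ≤ n * τ ∧ n * τ ≤ t + τ := by
  refine ⟨⌈t / τ⌉₊, (div_le_iff₀ hτ).1 (Nat.le_ceil _), ?_⟩
  have := mul_le_mul_of_nonneg_right (Nat.ceil_lt_add_one (div_nonneg ht hτ.le)).le hτ.le
  rwa [add_mul, div_mul_cancel₀ _ hτ.ne', one_mul] at this

section ReversalActions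

variable {S : Type u} [MetricSpace S] {Γ : Type v} [Group Γ] [MulAction Γ S] [IsIsometricSMul Γ S]
  {e τ C W : ℝ} {g a : Γ} {x : S}

/-- Near the part where the two rough rays run together, `g ^ j` and `a * g ^ j * a⁻¹` translate by
opposite amounts. -/
theorem IsGromovHyperbolic.dist_conj_pow_mul_pow_smul_le (hS : IsGromovHyperbolic e S)
    (hγ : IsRoughRay (fun n => g ^ n • x) τ C) {Q β : ℝ} {M P : ℕ}
    (hclose : ∀ i ≤ P, ∀ k ≤ M,
      dist (g ^ i • x) (a • g ^ k • x) ≤ |i * τ - (β + (M - k) * τ)| + Q)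
    {i j : ℕ} (hj : j ≤ M) (hij : i + j ≤ P) (hi : β ≤ i * τ) (hij' : (i + j) * τ ≤ β + M * τ) :
    dist (g ^ i • x) ((a * g ^ j * a⁻¹ * g ^ j) • g ^ i • x) ≤ 2 * Q + e := by
  obtain ⟨m, rfl⟩ := Nat.exists_eq_add_of_le hj
  have hshift (k : ℕ) : dist ((a * g ^ j * a⁻¹ * g ^ j) • g ^ i • x) (a • g ^ (j + k) • x) =
      dist (g ^ (i + j) • x) (a • g ^ k • x) := by
    rw [← dist_smul (a * g ^ j * a⁻¹) (g ^ (i + j) • x)]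
    simp only [smul_smul, mul_assoc, inv_mul_cancel_left, ← pow_add, add_comm i j]
  have hlen := hγ.mul_le_dist j m
  have hu := hclose i (by omega) (j + m) le_rfl
  have hv := hclose i (by omega) j hj
  have hu' := hclose (i + j) hij m (by omega)
  have hv' := hclose (i + j) hij 0 (Nat.zero_le _)
  rw [← hshift] at hu' hv'
  rw [add_zero] at hv'
  push_cast at hu hv hu' hv' hij'
  rw [abs_of_nonneg (by linarith)] at hu hu'
  rw [abs_of_nonpos (by linarith)] at hv hv'
  rw [← dist_smul a, dist_comm] at hlen
  refine hS.dist_le_of_dist_le_of_dist_le (u := a • g ^ (j + m) • x) (v := a • g ^ j • x)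
    (s := i * τ - β) (t := β + m * τ - i * τ) ?_ ?_ ?_ ?_ ?_ <;> linarith

/-- If the translate by `a` of an orbit segment of `g` ran backwards along the orbit of `g`, then
the elements `a * g ^ j * a⁻¹ * g ^ j` with `j ≤ N r` would almost fix two distant points. -/
theorem IsAcylindricalWith.projCoord_sub_le_of_isChiral (hS : IsGromovHyperbolic e S)
    {R : ℝ → ℝ} {N : ℝ → ℕ} (hac : IsAcylindricalWith Γ S R N) (hg : IsChiral g) (hτ : 0 < τ)
    (hγ : IsRoughRay (fun n => g ^ n • x) τ C) (hW : 0 < W) {r : ℝ}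
    (hr : r = 8 * W + 4 * C + 5 * e) {M : ℕ}
    (hM : R r + (N r + 2) * τ + (C + 4 * W + e) ≤ M * τ) (P : ℕ) (a : Γ) :
    projCoord x (g ^ P • x) (a • x) - projCoord x (g ^ P • x) (a • g ^ M • x) ≤
      dist x (g ^ M • x) - W := by
  by_contra! hprog
  have : Nonempty S := ⟨x⟩
  have he := hS.nonneg
  have hC := hγ.nonneg
  have hr0 : 0 < r := by linarith
  have hR : 0 < R r := (hac r hr0).1
  have hNτ : 0 ≤ N r * τ := by positivity
  obtain ⟨hP, hclose⟩ := hS.antiparallel_of_lt_projCoord_sub (M := M) (P := P) hγ (hγ.smul a)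
    hW.le (by linarith) (by simpa only [pow_zero, one_smul, dist_smul] using hprog)
  simp only [pow_zero, one_smul] at hP hclose
  obtain ⟨i, hβi, hiβ⟩ := exists_le_nat_mul_le_add hτ (dist_nonneg (x := x) (y := a • g ^ M • x))
  obtain ⟨k, hRk, hkR⟩ := exists_le_nat_mul_le_add hτ hR.le
  have hmem : ∀ l, i ≤ l → l ≤ i + k → ∀ j ≤ N r,
      dist (g ^ l • x) ((a * g ^ j * a⁻¹ * g ^ j) • g ^ l • x) ≤ r := by
    intro l hil hlk j hj
    have hil' : (i * τ : ℝ) ≤ l * τ := by gcongr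
    have hlj : (l + j : ℝ) * τ ≤ (i + k + N r) * τ := by
      gcongr
      exact_mod_cast hlk
    have hjM : (j * τ : ℝ) ≤ N r * τ := by gcongr
    refine (hS.dist_conj_pow_mul_pow_smul_le hγ hclose ?_ ?_ (hβi.trans hil') ?_).trans
      (by linarith)
    · exact_mod_cast le_of_mul_le_mul_right (b := (j : ℝ)) (c := M) (by linarith) hτ
    · exact_mod_cast le_of_mul_le_mul_right (b := (l + j : ℝ)) (c := P) (by linarith) hτ
    · linarith
  obtain ⟨b, c, hbc, heq⟩ := hac.exists_lt_eq hr0 (hRk.trans (hγ.mul_le_dist i k)) fun j hj =>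
    ⟨hmem i le_rfl (i.le_add_right k) j hj, hmem (i + k) (i.le_add_right k) le_rfl j hj⟩
  exact hg (isAchiral_of_conj_pow_mul_pow_eq hbc heq)

end ReversalActions

/-! ### Operations on paths -/

section Paths

theorem hasUnitSpeedOn_congr {E : Type*} [PseudoEMetricSpace E] {f f' : ℝ → E} {s : Set ℝ}
    (h : HasUnitSpeedOn f s) (hff' : Set.EqOn f' f s) : HasUnitSpeedOn f' s := fun x hx y hy => by
  rw [eVariationOn.congr (hff'.mono Set.inter_subset_left)]
  exact h hx hy

theorem hasUnitSpeedOn_comp_sub {E : Type*} [PseudoEMetricSpace E] {f : ℝ → E} {s : Set ℝ}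
    (h : HasUnitSpeedOn f s) (c : ℝ) :
    HasUnitSpeedOn (fun t => f (t - c)) ((fun t => t - c) ⁻¹' s) := fun x hx y hy => by
  have hmono : MonotoneOn (fun t : ℝ => t - c) ((fun t => t - c) ⁻¹' s ∩ Set.Icc x y) :=
    fun _ _ _ _ hab => sub_le_sub_right hab c
  have hvar := eVariationOn.comp_eq_of_monotoneOn f (fun t : ℝ => t - c) hmono
  have hspeed := h hx hy
  rw [sub_sub_sub_cancel_right] at hspeed
  rw [Set.image_preimage_inter, Set.image_sub_const_Icc, hspeed] at hvar
  exact hvar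

variable {S : Type u} [MetricSpace S]

namespace ArcPath

theorem dist_le (p : ArcPath S) {s t : ℝ} (hs : 0 ≤ s) (hst : s ≤ t) (ht : t ≤ p.len) :
    dist (p.toFun s) (p.toFun t) ≤ t - s := by
  have hs' : s ∈ Set.Icc 0 p.len := ⟨hs, hst.trans ht⟩
  have ht' : t ∈ Set.Icc 0 p.len := ⟨hs.trans hst, ht⟩
  have hvar := eVariationOn.edist_le p.toFun (s := Set.Icc 0 p.len ∩ Set.Icc s t)
    ⟨hs', le_rfl, hst⟩ ⟨ht', hst, le_rfl⟩
  rwa [p.unitSpeed hs' ht', NNReal.coe_one, one_mul, edist_dist,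
    ENNReal.ofReal_le_ofReal_iff (sub_nonneg.2 hst)] at hvar

theorem reverse_len (p : ArcPath S) : p.reverse.len = p.len := rfl

theorem reverse_source (p : ArcPath S) : p.reverse.source = p.target := by
  simp only [source, reverse, target, sub_zero]

theorem reverse_target (p : ArcPath S) : p.reverse.target = p.source := by
  simp only [source, reverse, target, sub_self]

/-- The path `p` followed by the path `q`. -/
noncomputable def concat (p q : ArcPath S) (h : p.target = q.source) : ArcPath S where
  len := p.len + q.len
  len_nonneg := add_nonneg p.len_nonneg q.len_nonneg
  toFun t := if t ≤ p.len then p.toFun t else q.toFun (t - p.len)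
  unitSpeed := by
    have hq := hasUnitSpeedOn_comp_sub q.unitSpeed p.len
    rw [Set.preimage_sub_const_Icc, zero_add, add_comm] at hq
    refine HasUnitSpeedOn.Icc_Icc (y := p.len) ?_ ?_
    · exact hasUnitSpeedOn_congr p.unitSpeed fun t ht => if_pos ht.2
    · refine hasUnitSpeedOn_congr hq fun t ht => ?_
      rcases ht.1.eq_or_lt with rfl | hlt
      · simpa [target, source] using h
      · exact if_neg hlt.not_ge

variable {p q : ArcPath S} (h : p.target = q.source)

theorem concat_len : (p.concat q h).len = p.len + q.len := rfl

theorem concat_toFun_left {t : ℝ} (ht : t ≤ p.len) : (p.concat q h).toFun t = p.toFun t :=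
  if_pos ht

theorem concat_toFun_right {t : ℝ} (ht : 0 ≤ t) :
    (p.concat q h).toFun (p.len + t) = q.toFun t := by
  rcases ht.eq_or_lt with rfl | hlt
  · rw [add_zero, concat_toFun_left h le_rfl]
    exact h
  · refine (if_neg (by linarith)).trans ?_
    rw [add_sub_cancel_left]

theorem concat_source : (p.concat q h).source = p.source := concat_toFun_left h p.len_nonneg

theorem concat_target : (p.concat q h).target = q.target := concat_toFun_right h q.len_nonneg

/-- The translate `a p` of the path `p` by an element `a` of a group acting by isometries. -/
def translate {Γ : Type v} [Group Γ] [MulAction Γ S] [IsIsometricSMul Γ S] (a : Γ)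
    (p : ArcPath S) : ArcPath S where
  len := p.len
  len_nonneg := p.len_nonneg
  toFun t := a • p.toFun t
  unitSpeed x hx y hy := by
    simpa only [eVariationOn, edist_smul_left] using p.unitSpeed hx hy

end ArcPath

end Paths

/-! ### Counting copies -/

theorem card_mul_le_sub_of_monotoneOn {ψ : ℝ → ℝ} {ℓ W b : ℝ} (hb : 0 ≤ b)
    (hψ : MonotoneOn ψ (Set.Icc 0 b)) (hℓ : 0 ≤ ℓ) (F : Finset ℝ)
    (hF : ∀ t ∈ F, 0 ≤ t ∧ t + ℓ ≤ b) (hsep : ∀ t ∈ F, ∀ t' ∈ F, t ≠ t' → ℓ ≤ |t - t'|)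
    (hjump : ∀ t ∈ F, W ≤ ψ (t + ℓ) - ψ t) : F.card * W ≤ ψ b - ψ 0 := by
  suffices H : ∀ c, 0 ≤ c → c ≤ b → (∀ t ∈ F, t + ℓ ≤ c) → F.card * W ≤ ψ c - ψ 0 from
    H b hb le_rfl fun t ht => (hF t ht).2
  clear hb
  induction F using Finset.induction_on_max with
  | empty =>
    intro c hc hcb _
    simpa using hψ ⟨le_rfl, hc.trans hcb⟩ ⟨hc, hcb⟩ hc
  | insert a F hlt ih =>
    intro c hc hcb hFc
    simp only [Finset.forall_mem_insert] at hF hsep hjump hFc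
    have hFa : ∀ t ∈ F, t + ℓ ≤ a := fun t ht => by
      have hta := hsep.1.2 t ht (hlt t ht).ne'
      rw [abs_of_pos (sub_pos.2 (hlt t ht))] at hta
      linarith
    have hbefore : F.card * W ≤ ψ a - ψ 0 :=
      ih hF.2 (fun t ht => (hsep.2 t ht).2) hjump.2 a hF.1.1 (by linarith) hFa
    have hafter : ψ (a + ℓ) ≤ ψ c := hψ ⟨by linarith, by linarith⟩ ⟨hc, hcb⟩ hFc.1
    rw [Finset.card_insert_of_notMem fun h => (hlt a h).ne rfl]
    push_cast
    linarith

section Counting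

variable {Γ : Type v} [Group Γ] {S : Type u} [MetricSpace S] [MulAction Γ S]
  {w α β : ArcPath S} {t : ℝ}

theorem isCopyAt_self (w : ArcPath S) : IsCopyAt Γ w w 0 :=
  ⟨le_rfl, (zero_add _).le, 1, fun s _ => by rw [zero_add, one_smul]⟩

theorem IsCopyAt.concat_left (ht : IsCopyAt Γ w α t) (h : α.target = β.source) :
    IsCopyAt Γ w (α.concat β h) t := by
  obtain ⟨h0, hlen, a, ha⟩ := ht
  refine ⟨h0, hlen.trans (le_add_of_nonneg_right β.len_nonneg), a, fun s hs => ?_⟩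
  rw [ArcPath.concat_toFun_left h (by linarith [hs.2]), ha s hs]

theorem IsCopyAt.concat_right (ht : IsCopyAt Γ w β t) (h : α.target = β.source) :
    IsCopyAt Γ w (α.concat β h) (α.len + t) := by
  obtain ⟨h0, hlen, a, ha⟩ := ht
  refine ⟨add_nonneg α.len_nonneg h0, ?_, a, fun s hs => ?_⟩
  · rw [add_assoc]
    exact add_le_add_right hlen α.len
  · rw [add_assoc, ArcPath.concat_toFun_right h (add_nonneg h0 hs.1), ha s hs]

theorem isCopyAt_translate [IsIsometricSMul Γ S] (a : Γ) :
    IsCopyAt Γ w (α.translate a) t ↔ IsCopyAt Γ w α t := by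
  refine and_congr_right fun _ => and_congr_right fun _ => ⟨?_, ?_⟩
  · rintro ⟨b, hb⟩
    exact ⟨a⁻¹ * b, fun s hs => by rw [mul_smul, ← hb s hs, eq_inv_smul_iff]; rfl⟩
  · rintro ⟨b, hb⟩
    exact ⟨a * b, fun s hs => by rw [mul_smul, ← hb s hs]; rfl⟩

variable (Γ) in
/-- `F` is a set of starting times of non-overlapping copies of `w` in `α`; `copyCount` is the
largest cardinality of such a set. -/
def IsCopyPacking (w α : ArcPath S) (F : Finset ℝ) : Prop :=
  (∀ t ∈ F, IsCopyAt Γ w α t) ∧ ∀ t ∈ F, ∀ t' ∈ F, t ≠ t' → w.len ≤ |t - t'|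

theorem IsCopyPacking.card_mul_le {F : Finset ℝ} (hF : IsCopyPacking Γ w α F) {ψ : ℝ → ℝ} {W : ℝ}
    (hψ : MonotoneOn ψ (Set.Icc 0 α.len))
    (hjump : ∀ t, IsCopyAt Γ w α t → W ≤ ψ (t + w.len) - ψ t) :
    F.card * W ≤ ψ α.len - ψ 0 :=
  card_mul_le_sub_of_monotoneOn α.len_nonneg hψ w.len_nonneg F
    (fun t ht => ⟨(hF.1 t ht).1, (hF.1 t ht).2.1⟩) hF.2 fun t ht => hjump t (hF.1 t ht)

theorem IsCopyPacking.card_mul_len_le {F : Finset ℝ} (hF : IsCopyPacking Γ w α F) :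
    F.card * w.len ≤ α.len := by
  simpa using hF.card_mul_le (ψ := id) (W := w.len) (monotone_id.monotoneOn _) fun t _ => by simp

theorem IsCopyPacking.concat {F G : Finset ℝ} (hF : IsCopyPacking Γ w α F)
    (hG : IsCopyPacking Γ w β G) (h : α.target = β.source) :
    IsCopyPacking Γ w (α.concat β h) (F ∪ G.image (α.len + ·)) := by
  have hcross : ∀ t ∈ F, ∀ s ∈ G, w.len ≤ α.len + s - t := fun t ht s hs => by
    linarith [(hF.1 t ht).2.1, (hG.1 s hs).1]
  refine ⟨?_, ?_⟩
  all_goals simp only [Finset.forall_mem_union, Finset.forall_mem_image]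
  · exact ⟨fun t ht => (hF.1 t ht).concat_left h, fun s hs => (hG.1 s hs).concat_right h⟩
  · refine ⟨fun t ht => ⟨hF.2 t ht, fun s hs _ => ?_⟩, fun s hs => ⟨fun t ht _ => ?_, ?_⟩⟩
    · rw [abs_sub_comm]
      exact (hcross t ht s hs).trans (le_abs_self _)
    · exact (hcross t ht s hs).trans (le_abs_self _)
    · intro s' hs' hne
      rw [add_sub_add_left_eq_sub]
      exact hG.2 s hs s' hs' (ne_of_apply_ne _ hne)

theorem bddAbove_card_isCopyPacking (hw : 0 < w.len) (α : ArcPath S) :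
    BddAbove {n : ℕ | ∃ F : Finset ℝ, F.card = n ∧ IsCopyPacking Γ w α F} := by
  refine ⟨⌊α.len / w.len⌋₊, ?_⟩
  rintro _ ⟨F, rfl, hF⟩
  exact Nat.le_floor ((le_div_iff₀ hw).2 hF.card_mul_len_le)

theorem IsCopyPacking.card_le_copyCount (hw : 0 < w.len) {F : Finset ℝ}
    (hF : IsCopyPacking Γ w α F) : F.card ≤ copyCount Γ w α :=
  le_csSup (bddAbove_card_isCopyPacking hw α) ⟨F, rfl, hF⟩

variable (Γ) in
theorem exists_isCopyPacking_card_eq (hw : 0 < w.len) (α : ArcPath S) :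
    ∃ F : Finset ℝ, F.card = copyCount Γ w α ∧ IsCopyPacking Γ w α F :=
  Nat.sSup_mem (s := {n : ℕ | ∃ F : Finset ℝ, F.card = n ∧ IsCopyPacking Γ w α F})
    ⟨0, ∅, rfl, by simp [IsCopyPacking]⟩ (bddAbove_card_isCopyPacking hw α)

theorem one_le_copyCount_self (hw : 0 < w.len) : 1 ≤ copyCount Γ w w := by
  have hF : IsCopyPacking Γ w w {0} := by simp [IsCopyPacking, isCopyAt_self]
  simpa using hF.card_le_copyCount hw

theorem copyCount_translate [IsIsometricSMul Γ S] (a : Γ) (w α : ArcPath S) :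
    copyCount Γ w (α.translate a) = copyCount Γ w α := by
  simp only [copyCount, isCopyAt_translate]

theorem copyCount_add_le_concat (hw : 0 < w.len) (h : α.target = β.source) :
    copyCount Γ w α + copyCount Γ w β ≤ copyCount Γ w (α.concat β h) := by
  obtain ⟨F, hcF, hF⟩ := exists_isCopyPacking_card_eq Γ hw α
  obtain ⟨G, hcG, hG⟩ := exists_isCopyPacking_card_eq Γ hw β
  have hdisj : Disjoint F (G.image (α.len + ·)) := by
    rw [Finset.disjoint_left]
    intro t ht ht'
    obtain ⟨s, hs, rfl⟩ := Finset.mem_image.1 ht'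
    linarith [(hF.1 _ ht).2.1, (hG.1 s hs).1]
  have hle := (hF.concat hG h).card_le_copyCount hw
  rwa [Finset.card_union_of_disjoint hdisj,
    Finset.card_image_of_injective _ (add_right_injective α.len), hcF, hcG] at hle

end Counting

/-! ### The weighted distance -/

/-- Any two points of `S` are joined by a path of finite length. -/
def IsRectifiablyConnected (S : Type u) [MetricSpace S] : Prop :=
  ∀ x y : S, ∃ α : ArcPath S, α.source = x ∧ α.target = y

theorem IsHyperbolicSpace.isRectifiablyConnected {δ : ℝ} {S : Type u} [MetricSpace S]
    (hS : IsHyperbolicSpace δ S) : IsRectifiablyConnected S := fun x y =>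
  (hS.1 x y).imp fun _ h => ⟨h.1, h.2.1⟩

section Weighted

variable {Γ : Type v} [Group Γ] {S : Type u} [MetricSpace S] [MulAction Γ S] {w : ArcPath S}
  {W : ℝ} {x y : S}

variable (Γ) in
/-- The distance from `x` to `y` when each copy of `w` along a path is rebated by `W`: the infimum
`inf_α (|α| - W |α|_w)` in the definition of `c_{w,W}([x,y])`. -/
noncomputable def weightedDist (w : ArcPath S) (W : ℝ) (x y : S) : ℝ :=
  sInf {v : ℝ | ∃ α : ArcPath S, α.source = x ∧ α.target = y ∧ v = α.len - W * copyCount Γ w α}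

theorem efFun_eq (w : ArcPath S) (W : ℝ) (x : S) (a : Γ) :
    efFun Γ w W x a = weightedDist Γ w.reverse W x (a • x) - weightedDist Γ w W x (a • x) :=
  sub_sub_sub_cancel_left _ _ _

theorem mul_copyCount_le_len (hw : 0 < w.len) (hW : W ≤ w.len) (α : ArcPath S) :
    W * copyCount Γ w α ≤ α.len := by
  obtain ⟨F, hcF, hF⟩ := exists_isCopyPacking_card_eq Γ hw α
  calc W * copyCount Γ w α ≤ w.len * copyCount Γ w α := by gcongr
    _ = F.card * w.len := by rw [hcF, mul_comm]
    _ ≤ α.len := hF.card_mul_len_le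

theorem weightedDist_nonneg (hw : 0 < w.len) (hW : W ≤ w.len) (x y : S) :
    0 ≤ weightedDist Γ w W x y :=
  Real.sInf_nonneg <| by
    rintro _ ⟨α, -, -, rfl⟩
    exact sub_nonneg.2 (mul_copyCount_le_len hw hW α)

theorem weightedDist_le (hw : 0 < w.len) (hW : W ≤ w.len) (α : ArcPath S) :
    weightedDist Γ w W α.source α.target ≤ α.len - W * copyCount Γ w α := by
  refine csInf_le ⟨0, ?_⟩ ⟨α, rfl, rfl, rfl⟩
  rintro _ ⟨β, -, -, rfl⟩
  exact sub_nonneg.2 (mul_copyCount_le_len hw hW β)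

theorem IsRectifiablyConnected.le_weightedDist (hS : IsRectifiablyConnected S) {c : ℝ}
    (h : ∀ α : ArcPath S, α.source = x → α.target = y → c ≤ α.len - W * copyCount Γ w α) :
    c ≤ weightedDist Γ w W x y := by
  obtain ⟨α, hα⟩ := hS x y
  refine le_csInf ⟨_, α, hα.1, hα.2, rfl⟩ ?_
  rintro _ ⟨β, hβx, hβy, rfl⟩
  exact h β hβx hβy

theorem IsRectifiablyConnected.weightedDist_triangle (hS : IsRectifiablyConnected S)
    (hw : 0 < w.len) (hW0 : 0 ≤ W) (hW : W ≤ w.len) (x y z : S) :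
    weightedDist Γ w W x z ≤ weightedDist Γ w W x y + weightedDist Γ w W y z := by
  rw [← sub_le_iff_le_add]
  refine hS.le_weightedDist fun α hαx hαy => ?_
  rw [sub_le_comm]
  refine hS.le_weightedDist fun β hβy hβz => ?_
  have h : α.target = β.source := hαy.trans hβy.symm
  have hle := weightedDist_le (Γ := Γ) hw hW (α.concat β h)
  rw [ArcPath.concat_source, ArcPath.concat_target, hαx, hβz, ArcPath.concat_len] at hle
  have hcount : W * (copyCount Γ w α + copyCount Γ w β) ≤ W * copyCount Γ w (α.concat β h) :=
    mul_le_mul_of_nonneg_left (by exact_mod_cast copyCount_add_le_concat hw h) hW0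
  linarith

theorem IsRectifiablyConnected.weightedDist_smul_le [IsIsometricSMul Γ S]
    (hS : IsRectifiablyConnected S) (hw : 0 < w.len) (hW : W ≤ w.len) (a : Γ) (x y : S) :
    weightedDist Γ w W (a • x) (a • y) ≤ weightedDist Γ w W x y := by
  refine hS.le_weightedDist ?_
  rintro α rfl rfl
  have hle := weightedDist_le (Γ := Γ) hw hW (α.translate a)
  rwa [copyCount_translate] at hle

theorem IsRectifiablyConnected.subadditive_weightedDist [IsIsometricSMul Γ S]
    (hS : IsRectifiablyConnected S) (hw : 0 < w.len) (hW0 : 0 ≤ W) (hW : W ≤ w.len) (g : Γ)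
    (x : S) : Subadditive fun n : ℕ => weightedDist Γ w W x (g ^ n • x) := fun m n =>
  calc weightedDist Γ w W x (g ^ (m + n) • x)
    _ ≤ weightedDist Γ w W x (g ^ m • x) +
          weightedDist Γ w W (g ^ m • x) (g ^ (m + n) • x) :=
        hS.weightedDist_triangle hw hW0 hW _ _ _
    _ ≤ weightedDist Γ w W x (g ^ m • x) + weightedDist Γ w W x (g ^ n • x) := by
        rw [pow_add, mul_smul]
        gcongr
        exact hS.weightedDist_smul_le hw hW _ _ _

theorem IsRectifiablyConnected.exists_tendsto_weightedDist_div [IsIsometricSMul Γ S]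
    (hS : IsRectifiablyConnected S) (hw : 0 < w.len) (hW0 : 0 ≤ W) (hW : W ≤ w.len) (g : Γ)
    (x : S) : ∃ l, Tendsto (fun n : ℕ => weightedDist Γ w W x (g ^ n • x) / n) atTop (𝓝 l) := by
  refine ⟨_, (hS.subadditive_weightedDist hw hW0 hW g x).tendsto_lim ⟨0, ?_⟩⟩
  rintro _ ⟨n, rfl⟩
  exact div_nonneg (weightedDist_nonneg hw hW _ _) n.cast_nonneg

/-- The function `t ↦ t - projCoord x y (α t)` measures the length that `α` wastes: it is monotone,
and each copy of `w` wastes at least `W`. -/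
theorem dist_le_len_sub_mul_copyCount (hw : 0 < w.len)
    (hprog : ∀ a : Γ, projCoord x y (a • w.target) - projCoord x y (a • w.source) ≤ w.len - W)
    {α : ArcPath S} (hαx : α.source = x) (hαy : α.target = y) :
    dist x y ≤ α.len - W * copyCount Γ w α := by
  obtain ⟨F, hcF, hF⟩ := exists_isCopyPacking_card_eq Γ hw α
  have hmono : MonotoneOn (fun t => t - projCoord x y (α.toFun t)) (Set.Icc 0 α.len) :=
    fun s hs t ht hst => by
      have hst' := (projCoord_sub_le_dist x y (α.toFun s) (α.toFun t)).trans
        (α.dist_le hs.1 hst ht.2)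
      linarith
  have hwaste := hF.card_mul_le hmono (W := W) fun t ⟨_, _, a, ha⟩ => by
    have hstart : α.toFun t = a • w.source := by
      simpa only [add_zero, ArcPath.source] using ha 0 ⟨le_rfl, w.len_nonneg⟩
    have hend : α.toFun (t + w.len) = a • w.target := ha w.len ⟨w.len_nonneg, le_rfl⟩
    rw [hstart, hend]
    linarith [hprog a]
  have hx : α.toFun 0 = x := hαx
  have hy : α.toFun α.len = y := hαy
  rw [hx, hy, hcF] at hwaste
  linarith [projCoord_right_sub_left x y]

end Weighted

/-! ### The spectral gap -/

section Gap

variable {Γ : Type v} [Group Γ] {S : Type u} [MetricSpace S] [MulAction Γ S]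
  [IsIsometricSMul Γ S]

theorem IsRectifiablyConnected.tendsto_efFun_div_and_le (hS : IsRectifiablyConnected S)
    {W τ c : ℝ} {g : Γ} {M : ℕ} (hM : 0 < M) {w : ArcPath S} (hw : 0 < w.len) (hW0 : 0 ≤ W)
    (hW : W ≤ w.len) {x : S} (hwx : w.source = x) (hwy : w.target = g ^ M • x)
    (hlen : w.len - W ≤ M * τ - c)
    (hback : ∀ n : ℕ, n * τ ≤ weightedDist Γ w.reverse W x (g ^ n • x)) :
    Tendsto (fun n : ℕ => efFun Γ w W x (g ^ n) / n) atTop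
        (𝓝 (homogenization (efFun Γ w W x) g)) ∧
      c / M ≤ homogenization (efFun Γ w W x) g := by
  obtain ⟨l₁, h₁⟩ := hS.exists_tendsto_weightedDist_div (w := w) hw hW0 hW g x
  obtain ⟨l₂, h₂⟩ := hS.exists_tendsto_weightedDist_div (w := w.reverse) hw hW0 hW g x
  have hlim : Tendsto (fun n : ℕ => efFun Γ w W x (g ^ n) / n) atTop (𝓝 (l₂ - l₁)) :=
    (h₂.sub h₁).congr fun n => by rw [efFun_eq, sub_div]
  have hl₁ : M * l₁ ≤ M * τ - c := by
    have hself := weightedDist_le (Γ := Γ) hw hW w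
    have hcount : W * 1 ≤ W * copyCount Γ w w := by
      gcongr
      exact_mod_cast one_le_copyCount_self hw
    have hM := mul_le_of_subadditive_of_tendsto (hS.subadditive_weightedDist hw hW0 hW g x) h₁ M
    rw [hwx, hwy] at hself
    linarith
  have hl₂ : τ ≤ l₂ := ge_of_tendsto h₂ <| by
    filter_upwards [eventually_gt_atTop 0] with n hn
    rw [le_div_iff₀ (by exact_mod_cast hn), mul_comm]
    exact hback n
  rw [homogenization, hlim.limUnder_eq]
  refine ⟨hlim, ?_⟩
  rw [div_le_iff₀ (by exact_mod_cast hM), mul_comm, mul_sub]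
  have : M * τ ≤ M * l₂ := by gcongr
  linarith

theorem AdmissibleConstants.tendsto_efFun_div_and_le [Nonempty S] {δ T K : ℝ}
    (h : AdmissibleConstants.{u} δ T K) (hδ : 0 ≤ δ) (hS : IsHyperbolicSpace δ S)
    {R : ℝ → ℝ} {N : ℝ → ℕ} (hac : IsAcylindricalWith Γ S R N) {g : Γ} (hg : IsLoxodromic S g)
    (hchiral : IsChiral g) {C r : ℝ} (hC : C = 4 * K + 9 * (6 * δ))
    (hr : r = 8 * (K + 1) + 4 * C + 5 * (6 * δ)) {M : ℕ}
    (hT : T ≤ actionLength S (g ^ M)) (hlong : 2 * K + 2 ≤ actionLength S (g ^ M))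
    (hM : R r + (N r + 2) * actionLength S g + (C + 4 * (K + 1) + 6 * δ) ≤
      M * actionLength S g)
    {x : S} (hx : IsAlmostMinimal δ (fun z : S => g ^ M • z) x) {w : ArcPath S}
    (hw : w.IsGeodesic x (g ^ M • x)) :
    Tendsto (fun n : ℕ => efFun Γ w (K + 1) x (g ^ n) / n) atTop
        (𝓝 (homogenization (efFun Γ w (K + 1) x) g)) ∧
      1 / (M : ℝ) ≤ homogenization (efFun Γ w (K + 1) x) g := by
  have hK : 0 < K := h.2.1
  have hlen := hw.len_eq
  have hray := h.isRoughRay_pow_smul_of_pow hS hδ hT hx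
  rw [← hC] at hray
  have hlo := hray.mul_le_dist_zero M
  have hup := (h.isRoughRay_pow_smul hS hT hx).dist_zero_le 1
  simp only [pow_zero, one_smul, pow_one, Nat.cast_one, one_mul] at hlo hup
  rw [actionLength_pow] at hup hlong
  have hM0 : 0 < M := by
    rw [Nat.pos_iff_ne_zero]
    rintro rfl
    simp only [Nat.cast_zero, zero_mul] at hlong
    linarith
  refine hS.isRectifiablyConnected.tendsto_efFun_div_and_le (τ := actionLength S g) hM0
    (by linarith) (by linarith) (by linarith) hw.1 hw.2.1 (by linarith) fun n => ?_
  refine (mul_actionLength_le g x n).trans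
    (hS.isRectifiablyConnected.le_weightedDist fun α hαx hαy => ?_)
  refine dist_le_len_sub_mul_copyCount (w := w.reverse) (by rw [w.reverse_len]; linarith)
    (fun a => ?_) hαx hαy
  rw [w.reverse_target, w.reverse_source, hw.1, hw.2.1, w.reverse_len, hlen]
  exact hac.projCoord_sub_le_of_isChiral (hS.isGromovHyperbolic hδ) hchiral hg hray
    (by linarith) hr hM n a

end Gap

end AcylGap

theorem mainTheorem5 (δ : ℝ) (hδ : 0 < δ) :
    (∃ T K : ℝ, AdmissibleConstants.{u} δ T K) ∧
    ∀ T K : ℝ, AdmissibleConstants.{u} δ T K →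
    ∀ (R : ℝ → ℝ) (N : ℝ → ℕ),
    ∃ M : ℕ, 0 < M ∧
      ∀ (S : Type u) [MetricSpace S] [Nonempty S] (Γ : Type v) [Group Γ]
        [MulAction Γ S] [IsIsometricSMul Γ S],
        IsHyperbolicSpace δ S → IsAcylindricalWith Γ S R N →
        ∀ g : Γ, IsLoxodromic S g → IsChiral g →
          2 * K + 2 ≤ actionLength S (g ^ M) ∧
          ∀ x₀ : S, IsAlmostMinimal δ (fun z : S => g ^ M • z) x₀ →
          ∀ w : ArcPath S, w.IsGeodesic x₀ (g ^ M • x₀) →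
            Tendsto (fun n : ℕ => efFun Γ w (K + 1) x₀ (g ^ n) / n) atTop
              (𝓝 (homogenization (efFun Γ w (K + 1) x₀) g)) ∧
            1 / (M : ℝ) ≤ homogenization (efFun Γ w (K + 1) x₀) g := by
  refine ⟨exists_admissibleConstants hδ, fun T K h R N => ?_⟩
  set C := 4 * K + 9 * (6 * δ) with hC
  set r := 8 * (K + 1) + 4 * C + 5 * (6 * δ) with hr
  obtain ⟨m, hm⟩ := exists_nat_ge (max T (max (2 * K + 2) (R r + (C + 4 * (K + 1) + 6 * δ))))
  obtain ⟨hmT, hmK, hmR⟩ : T ≤ m ∧ 2 * K + 2 ≤ m ∧ R r + (C + 4 * (K + 1) + 6 * δ) ≤ m := by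
    simpa only [max_le_iff] using hm
  refine ⟨N r + 2 + N (C + 1) * m, by omega, fun S _ _ Γ _ _ _ hS hac g hg hchiral => ?_⟩
  have hpos : 0 < actionLength S g := hg
  have hgap : m * 1 ≤ m * (N (C + 1) * actionLength S g) := by
    gcongr
    exact h.one_le_mul_actionLength hS hδ hac hg
  have hlong : m + (N r + 2) * actionLength S g ≤
      (N r + 2 + N (C + 1) * m : ℕ) * actionLength S g := by
    push_cast
    linarith
  have hm_le : m ≤ actionLength S (g ^ (N r + 2 + N (C + 1) * m)) := by
    rw [actionLength_pow]
    exact (le_add_of_nonneg_right (by positivity)).trans hlong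
  exact ⟨hmK.trans hm_le, fun x hx w hw => h.tendsto_efFun_div_and_le hδ.le hS hac hg hchiral hC hr
    (hmT.trans hm_le) (hmK.trans hm_le) (by linarith) hx hw⟩
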